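/- For real numbers $a,b$ such that $a+b\notin\{0,-1,-2,\dots\}$, let $$\Phi_{a,b}(z)=M(a,a+b;z)=\sum_{k=0}^{\infty}\frac{(a)_k}{(a+b)_k}\,\frac{z^k}{k!}\qquad(z\in\mathbb C),$$ where $(x)_k=x(x+1)\cdots(x+k-1)$. If neither $a$ nor $b$ belongs to $\{0,-1,-2,\dots\}$ (in particular if $a,b>0$), then $\Phi_{a,b}$ has infinitely many complex zeros, which can be arranged in a sequence $(z_{a,b;k})_{k\ge 1}$ in which each zero is repeated according to its multiplicity, and, for every such sequence, $$\Phi_{a,b}(z)=e^{az/(a+b)}\prod_{k=1}^{\infty}\left(1-\frac{z}{z_{a,b;k}}\right)e^{z/z_{a,b;k}}\qquad\text{for all } z\in\mathbb C .$$ The product converges locally uniformly on $\mathbb C$ and independently of the order of its factors. If $a$ or $b$ belongs to $\{0,-1,-2,\dots\}$ (and still $a+b\notin\{0,-1,-2,\dots\}$), the same factorization holds, the product being taken over the family of all zeros of $\Phi_{a,b}$, repeated according to multiplicity. -/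

import Mathlib

/-- The Kummer function `M(a, b; z) = ∑ₖ (a)ₖ / (b)ₖ * zᵏ / k!`, where `(a)ₖ` is the rising
factorial (for `b` not a nonpositive integer). -/
noncomputable def kummerM (a b z : ℂ) : ℂ :=
  ∑' k : ℕ, (ascPochhammer ℂ k).eval a / (ascPochhammer ℂ k).eval b * (z ^ k / (k.factorial : ℂ))

/-- `Φ_{a,b}(z) = M(a, a + b; z)`. -/
noncomputable def kummerPhi (a b : ℝ) (z : ℂ) : ℂ :=
  kummerM (a : ℂ) ((a : ℂ) + (b : ℂ)) z

/-- The family `z` lists the zeros of the entire function `f`, each one repeated according to its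
multiplicity: every `w` occurs exactly as often as the order of vanishing of `f` at `w`
(not at all when `f w ≠ 0`). -/
def IsZeroEnumeration {ι : Type*} (f : ℂ → ℂ) (z : ι → ℂ) : Prop :=
  ∀ w : ℂ, {k : ι | z k = w}.encard = analyticOrderAt f w

/-!
The Kummer function `Φ(z) = M(a, a + b; z)` is entire of exponential type, so the factorization is
the Hadamard factorization in genus one, with exponential factor determined by
`Φ 0 = 1` and `Φ' 0 = a / (a + b)`.

Hadamard's theorem for a function `f` with `f 0 = 1` and `‖f z‖ ≤ C * exp (τ * ‖z‖)` is obtained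
directly, without comparing `f` with its canonical product. Divide `f` by the linear factors
`1 - z / ζ k` of the zeros with `‖ζ k‖ ≤ R`. By the maximum principle on the circle of radius
`3 * R` the quotient `g` is bounded by `C * exp (3 * τ * R) / 2 ^ n(R)`, where `n(R)` is the
number of these zeros (`IsZeroEnumeration.exists_quotient`). At the origin this gives `n(R) = O(R)`, hence
`∑ 1 / ‖ζ k‖ ^ 2 < ∞` and the locally uniform convergence of the canonical product. On the disc of
radius `R`, `g = exp h` with `Re h = O(R)`, so Borel–Carathéodory gives `h z = h' 0 * z + O(1 / R)`
(`norm_sub_deriv_mul_le_of_re_le`). Since `h' 0 = f' 0 + ∑ 1 / ζ k`, the limit `R → ∞` is the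
factorization `IsZeroEnumeration.eq_exp_mul_tprod`.

If `Φ` had finitely many zeros, the factorization would read `Φ z = P z * exp (γ * z)` with a
polynomial `P`. Substituting this in Kummer's equation `z w'' + (a + b - z) w' = a w` and comparing
leading coefficients forces `γ = 0` and `a = -deg P`, or `γ = 1` and `b = -deg P`
(`exists_natCast_of_eval_mul_exp_eq_kummerM`). When neither `a` nor `b` is a nonpositive
integer the zeros are therefore countably infinite, and any bijection with `ℕ` gives the sequence.
-/

open Filter Metric Set Topology

/-! ### Dividing out zeros -/

/-- An entire function with a zero at `c ≠ 0` is divisible by `1 - z / c` among entire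
functions. -/
theorem exists_eq_one_sub_div_mul {f : ℂ → ℂ} (hf : Differentiable ℂ f) {c : ℂ} (hc : c ≠ 0)
    (hfc : f c = 0) : ∃ g : ℂ → ℂ, Differentiable ℂ g ∧ ∀ z, f z = (1 - z / c) * g z := by
  refine ⟨fun z => -c * dslope f c z, ?_, fun z => ?_⟩
  · have h : DifferentiableOn ℂ (dslope f c) univ :=
      (Complex.differentiableOn_dslope univ_mem).2 hf.differentiableOn
    exact (differentiableOn_univ.1 h).const_mul _
  · have h := sub_smul_dslope f c z
    rw [hfc, sub_zero, smul_eq_mul] at h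
    rw [← h]
    field_simp
    ring

theorem analyticOrderAt_one_sub_div {c : ℂ} (hc : c ≠ 0) (w : ℂ) :
    analyticOrderAt (fun z : ℂ => 1 - z / c) w = if c = w then 1 else 0 := by
  split_ifs with h
  · subst h
    have hd : HasDerivAt (fun z : ℂ => 1 - z / c) (-(1 / c)) c :=
      ((hasDerivAt_id c).div_const c).const_sub 1
    apply AnalyticAt.analyticOrderAt_eq_one_of_zero_deriv_ne_zero
    · fun_prop
    · simp [hc]
    · rw [hd.deriv]; simpa using hc
  · rw [AnalyticAt.analyticOrderAt_eq_zero (by fun_prop)]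
    intro h'
    apply h
    field_simp at h'
    linear_combination h'

/-- Finitely many zeros can be divided out simultaneously, as long as no point is used more often
than its multiplicity allows; the order of the quotient drops accordingly. -/
theorem exists_eq_prod_one_sub_div_mul {ι : Type*} (ζ : ι → ℂ) (S : Finset ι) :
    ∀ f : ℂ → ℂ, Differentiable ℂ f → (∀ k ∈ S, ζ k ≠ 0) →
      (∀ w, ({k ∈ S | ζ k = w}.card : ℕ∞) ≤ analyticOrderAt f w) →
      ∃ g : ℂ → ℂ, Differentiable ℂ g ∧ (∀ z, f z = (∏ k ∈ S, (1 - z / ζ k)) * g z) ∧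
        ∀ w, analyticOrderAt f w = ({k ∈ S | ζ k = w}.card : ℕ∞) + analyticOrderAt g w := by
  classical
  induction S using Finset.induction_on with
  | empty => exact fun f hf _ _ => ⟨f, hf, by simp, by simp⟩
  | insert k S hk ih =>
    intro f hf h0 hcard
    have hk0 : ζ k ≠ 0 := h0 k (by simp)
    have hins : ∀ w, ({j ∈ insert k S | ζ j = w}.card : ℕ∞) =
        (if ζ k = w then 1 else 0) + ({j ∈ S | ζ j = w}.card : ℕ∞) := by
      intro w
      rw [Finset.filter_insert]
      split_ifs with h
      · rw [Finset.card_insert_of_notMem (by simp [hk])]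
        push_cast
        rw [add_comm]
      · simp
    have hfk : f (ζ k) = 0 := by
      apply apply_eq_zero_of_analyticOrderAt_ne_zero
      intro h
      have := hcard (ζ k)
      rw [h, hins] at this
      simp at this
    obtain ⟨f₁, hf₁, hff₁⟩ := exists_eq_one_sub_div_mul hf hk0 hfk
    have hord : ∀ w, analyticOrderAt f w =
        (if ζ k = w then 1 else 0) + analyticOrderAt f₁ w := by
      intro w
      rw [← analyticOrderAt_one_sub_div hk0,
        ← analyticOrderAt_mul (by fun_prop) (hf₁.analyticAt w)]
      congr 1
      exact funext hff₁
    obtain ⟨g, hg, hfg, hgord⟩ := ih f₁ hf₁ (fun j hj => h0 j (by simp [hj])) (fun w => by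
      have h := hcard w
      rw [hins, hord] at h
      refine (ENat.add_le_add_iff_left ?_).1 h
      split_ifs <;> simp)
    refine ⟨g, hg, fun z => ?_, fun w => ?_⟩
    · rw [hff₁, hfg, Finset.prod_insert hk, mul_assoc]
    · rw [hord, hgord, hins, add_assoc]

/-! ### Logarithms and the Borel–Carathéodory estimate -/

/-- A zero-free holomorphic function on a disc has a holomorphic logarithm there. -/
theorem exists_eq_exp_on_ball {g : ℂ → ℂ} {R : ℝ} (hR : 0 < R)
    (hg : DifferentiableOn ℂ g (ball 0 R)) (hg0 : ∀ z ∈ ball (0 : ℂ) R, g z ≠ 0) (h1 : g 0 = 1) :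
    ∃ h : ℂ → ℂ, DifferentiableOn ℂ h (ball 0 R) ∧ h 0 = 0 ∧
      ∀ z ∈ ball (0 : ℂ) R, g z = Complex.exp (h z) := by
  have hd : DifferentiableOn ℂ (fun z => deriv g z / g z) (ball 0 R) :=
    (hg.deriv isOpen_ball).div hg hg0
  obtain ⟨h, h0, hh⟩ := hd.isExactOn_ball.with_val_at 0 0
  refine ⟨h, fun z hz => (hh z hz).differentiableAt.differentiableWithinAt, h0, fun z hz => ?_⟩
  -- `h` is the primitive of `g' / g` vanishing at `0`, so `g * exp (-h)` is constant
  have hconst : ∀ w ∈ ball (0 : ℂ) R, HasDerivAt (fun z => g z * Complex.exp (-h z)) 0 w := by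
    intro w hw
    have hgw : HasDerivAt g (deriv g w) w :=
      (hg.differentiableAt (isOpen_ball.mem_nhds hw)).hasDerivAt
    refine (hgw.mul (hh w hw).neg.cexp).congr_deriv ?_
    have := hg0 w hw
    field_simp
    ring
  have heq := (convex_ball (0 : ℂ) R).is_const_of_fderivWithin_eq_zero (𝕜 := ℂ)
    (f := fun z => g z * Complex.exp (-h z))
    (fun w hw => (hconst w hw).differentiableAt.differentiableWithinAt)
    (fun w hw => by
      rw [fderivWithin_of_isOpen isOpen_ball hw]
      simpa using (hconst w hw).hasFDerivAt.fderiv) hz (mem_ball_self hR)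
  simp only [h0, h1, neg_zero, Complex.exp_zero, mul_one] at heq
  rw [Complex.exp_neg] at heq
  exact (mul_inv_eq_one₀ (Complex.exp_ne_zero _)).1 heq

/-- A one-sided bound on the real part controls the quadratic remainder of a holomorphic function:
Borel–Carathéodory bounds the function itself on the half disc, and the Schwarz lemma applied to
two successive difference quotients gains the factor `‖z‖ ^ 2 / R ^ 2`. -/
theorem norm_sub_deriv_mul_le_of_re_le {h : ℂ → ℂ} {R M : ℝ} (hR : 0 < R) (hM : 0 < M)
    (hh : DifferentiableOn ℂ h (ball 0 R)) (h0 : h 0 = 0) (hre : ∀ z ∈ ball (0 : ℂ) R, (h z).re ≤ M)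
    {z : ℂ} (hz : ‖z‖ < R / 2) : ‖h z - deriv h 0 * z‖ ≤ 16 * M * ‖z‖ ^ 2 / R ^ 2 := by
  have hR2 : (0 : ℝ) < R / 2 := by positivity
  have hsub : ball (0 : ℂ) (R / 2) ⊆ ball 0 R := ball_subset_ball (by linarith)
  have hnhds : ball (0 : ℂ) (R / 2) ∈ 𝓝 0 := ball_mem_nhds _ hR2
  have hd : DifferentiableOn ℂ h (ball 0 (R / 2)) := hh.mono hsub
  have hb : ∀ w ∈ ball (0 : ℂ) (R / 2), ‖h w‖ ≤ 2 * M := by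
    intro w hw
    have hw' : ‖w‖ < R / 2 := by simpa using hw
    refine (Complex.borelCaratheodory_zero hM hh hre hR (hsub hw) h0).trans ?_
    rw [div_le_iff₀ (by linarith)]
    nlinarith
  have hq : ∀ w ∈ ball (0 : ℂ) (R / 2), ‖dslope h 0 w‖ ≤ 2 * M / (R / 2) := fun w hw =>
    Complex.norm_dslope_le_div_of_mapsTo_ball hd
      (fun x hx => by simpa [h0] using hb x hx) hw
  have hqd : DifferentiableOn ℂ (dslope h 0) (ball 0 (R / 2)) :=
    (Complex.differentiableOn_dslope hnhds).2 hd
  have hqq := Complex.norm_dslope_le_div_of_mapsTo_ball (R₂ := 2 * (2 * M / (R / 2))) hqd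
    (fun x hx => by
      rw [mem_closedBall, dist_eq_norm]
      refine (norm_sub_le _ _).trans ?_
      linarith [hq x hx, hq 0 (mem_ball_self hR2)]) (z := z) (by simpa using hz)
  have e1 := sub_smul_dslope h 0 z
  have e2 := sub_smul_dslope (dslope h 0) 0 z
  simp only [sub_zero, smul_eq_mul, h0, dslope_same] at e1 e2
  have e3 : h z - deriv h 0 * z = z ^ 2 * dslope (dslope h 0) 0 z := by
    rw [pow_two, mul_assoc, e2, ← e1]; ring
  rw [e3, norm_mul, norm_pow]
  calc ‖z‖ ^ 2 * ‖dslope (dslope h 0) 0 z‖ ≤ ‖z‖ ^ 2 * (2 * (2 * M / (R / 2)) / (R / 2)) := by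
        gcongr
    _ = 16 * M * ‖z‖ ^ 2 / R ^ 2 := by field_simp; ring

/-! ### Zeros of entire functions of exponential type -/

namespace IsZeroEnumeration

variable {ι : Type*} {f : ℂ → ℂ} {ζ : ι → ℂ}

theorem apply_eq_zero (hζ : IsZeroEnumeration f ζ) (k : ι) : f (ζ k) = 0 := by
  apply apply_eq_zero_of_analyticOrderAt_ne_zero
  rw [← hζ (ζ k), Set.encard_ne_zero]
  exact ⟨k, rfl⟩

theorem ne_zero (hζ : IsZeroEnumeration f ζ) (h1 : f 0 = 1) (k : ι) : ζ k ≠ 0 := by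
  intro h
  have := hζ.apply_eq_zero k
  simp [h, h1] at this

end IsZeroEnumeration

theorem analyticOrderAt_ne_top_of_apply_zero {f : ℂ → ℂ} (hf : Differentiable ℂ f) (h1 : f 0 = 1)
    (w : ℂ) : analyticOrderAt f w ≠ ⊤ := by
  rw [Ne, AnalyticOnNhd.analyticOrderAt_eq_top_iff_eq_zero w (fun z => hf.analyticAt z)]
  intro h
  simp [h] at h1

theorem finite_zeros_closedBall {f : ℂ → ℂ} (hf : Differentiable ℂ f) (h1 : f 0 = 1) (R : ℝ) :
    {w : ℂ | ‖w‖ ≤ R ∧ f w = 0}.Finite := by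
  have h := AnalyticOnNhd.preimage_zero_mem_codiscrete (𝕜 := ℂ) (f := f) (x := 0)
    (fun z _ => hf.analyticAt z) (by simp [h1])
  have h2 := (isCompact_closedBall (0 : ℂ) R).finite_sdiff_of_mem_codiscreteWithin
    (codiscreteWithin_mono (subset_univ _) h)
  refine h2.subset fun w hw => ⟨by simpa using hw.1, by simpa using hw.2⟩

theorem IsZeroEnumeration.finite_norm_le {ι : Type*} {f : ℂ → ℂ} {ζ : ι → ℂ}
    (hζ : IsZeroEnumeration f ζ) (hf : Differentiable ℂ f) (h1 : f 0 = 1) (R : ℝ) :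
    {k | ‖ζ k‖ ≤ R}.Finite := by
  refine ((finite_zeros_closedBall hf h1 R).preimage' (f := ζ) fun w _ => ?_).subset
    fun k hk => ⟨hk, hζ.apply_eq_zero k⟩
  rw [← Set.encard_ne_top_iff]
  exact (hζ w).trans_ne (analyticOrderAt_ne_top_of_apply_zero hf h1 w)

/-- Dividing `f` by the linear factors of its zeros in the disc of radius `R` leaves an entire
function without zeros in that disc. On the circle of radius `3 * R` each linear factor has modulus
at least `2`, so the maximum principle bounds the quotient by the growth of `f`, with a gain of one
factor `2` for each zero. -/
theorem IsZeroEnumeration.exists_quotient {ι : Type*} {f : ℂ → ℂ} {ζ : ι → ℂ}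
    (hζ : IsZeroEnumeration f ζ) (hf : Differentiable ℂ f) (h1 : f 0 = 1) {C τ : ℝ}
    (hC : ∀ z, ‖f z‖ ≤ C * Real.exp (τ * ‖z‖)) {R : ℝ} (hR : 0 < R) (S : Finset ι)
    (hS : ∀ k, k ∈ S ↔ ‖ζ k‖ ≤ R) :
    ∃ g : ℂ → ℂ, Differentiable ℂ g ∧ (∀ z, f z = (∏ k ∈ S, (1 - z / ζ k)) * g z) ∧ g 0 = 1 ∧
      (∀ z ∈ ball (0 : ℂ) R, g z ≠ 0) ∧
      ∀ z ∈ ball (0 : ℂ) (3 * R), ‖g z‖ ≤ C * Real.exp (τ * (3 * R)) / 2 ^ S.card := by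
  classical
  have hfib : ∀ w, ({k ∈ S | ζ k = w}.card : ℕ∞) ≤ {k | ζ k = w}.encard := fun w => by
    rw [← Set.encard_coe_eq_coe_finsetCard]
    exact Set.encard_le_encard fun k hk => by simpa using (Finset.mem_filter.1 hk).2
  obtain ⟨g, hg, hfg, hord⟩ := exists_eq_prod_one_sub_div_mul ζ S f hf
    (fun k _ => hζ.ne_zero h1 k) (fun w => (hfib w).trans_eq (hζ w))
  refine ⟨g, hg, hfg, by simpa [h1] using (hfg 0).symm, fun z hz => ?_, fun z hz => ?_⟩
  · have hzR : ‖z‖ < R := by simpa using hz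
    have hset : {k | ζ k = z} = (({k ∈ S | ζ k = z} : Finset ι) : Set ι) := by
      ext k
      simp only [mem_ofPred_eq, Finset.coe_filter, hS]
      exact ⟨fun h => ⟨by rw [h]; exact hzR.le, h⟩, fun h => h.2⟩
    have h := hord z
    rw [← hζ z, hset, Set.encard_coe_eq_coe_finsetCard] at h
    have h0 : analyticOrderAt g z = 0 := by
      have h' : (({k ∈ S | ζ k = z}.card : ℕ) : ℕ∞) + 0 =
        (({k ∈ S | ζ k = z}.card : ℕ) : ℕ∞) + analyticOrderAt g z := by rw [add_zero]; exact h
      exact (ENat.add_right_injective_of_ne_top (ENat.natCast_ne_top _) h').symm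
    exact (hg.analyticAt z).analyticOrderAt_eq_zero.1 h0
  · refine Complex.norm_le_of_forall_mem_frontier_norm_le isBounded_ball hg.diffContOnCl
      (fun w hw => ?_) (subset_closure hz)
    rw [frontier_ball _ (by positivity)] at hw
    have hw' : ‖w‖ = 3 * R := by simpa using hw
    have hprod : (2 : ℝ) ^ S.card ≤ ‖∏ k ∈ S, (1 - w / ζ k)‖ := by
      rw [norm_prod, ← Finset.prod_const]
      refine Finset.prod_le_prod (fun _ _ => zero_le_two) fun k hk => ?_
      have hk0 : 0 < ‖ζ k‖ := norm_pos_iff.2 (hζ.ne_zero h1 k)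
      have h3 : 3 ≤ ‖w / ζ k‖ := by
        rw [norm_div, le_div_iff₀ hk0, hw']
        linarith [(hS k).1 hk]
      have := norm_sub_norm_le (w / ζ k) 1
      rw [norm_one, norm_sub_rev] at this
      linarith
    rw [le_div_iff₀ (by positivity)]
    calc ‖g w‖ * 2 ^ S.card ≤ ‖g w‖ * ‖∏ k ∈ S, (1 - w / ζ k)‖ := by gcongr
      _ = ‖f w‖ := by rw [hfg, norm_mul, mul_comm]
      _ ≤ _ := by rw [← hw']; exact hC w

/-- An entire function of exponential type has at most `O(R)` zeros in the disc of radius `R`. -/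
theorem IsZeroEnumeration.exists_ncard_le {ι : Type*} {f : ℂ → ℂ} {ζ : ι → ℂ}
    (hζ : IsZeroEnumeration f ζ) (hf : Differentiable ℂ f) (h1 : f 0 = 1) {C τ : ℝ}
    (hC : ∀ z, ‖f z‖ ≤ C * Real.exp (τ * ‖z‖)) :
    ∃ A : ℝ, ∀ R, 1 ≤ R → ({k | ‖ζ k‖ ≤ R}.ncard : ℝ) ≤ A * R := by
  have hC1 : 1 ≤ C := by simpa [h1] using hC 0
  have hlog : 0 < Real.log 2 := Real.log_pos one_lt_two
  refine ⟨(Real.log C + 3 * τ) / Real.log 2, fun R hR => ?_⟩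
  have hfin := hζ.finite_norm_le hf h1 R
  obtain ⟨g, -, -, hg1, -, hgb⟩ := hζ.exists_quotient hf h1 hC (by linarith) hfin.toFinset
    (by simp)
  have h := hgb 0 (mem_ball_self (by linarith))
  rw [hg1, norm_one, le_div_iff₀ (by positivity), one_mul] at h
  have h2 := Real.log_le_log (by positivity) h
  rw [Real.log_pow, Real.log_mul (by positivity) (by positivity), Real.log_exp] at h2
  rw [Set.ncard_eq_toFinset_card _ hfin, div_mul_eq_mul_div, le_div_iff₀ hlog]
  nlinarith [Real.log_nonneg hC1]

/-- A family with at most `O(R)` members in the disc of radius `R` has convergence exponent at most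
one; in particular its inverse squares are summable. The members are grouped into dyadic annuli. -/
theorem summable_inv_norm_sq_of_ncard_le {ι : Type*} {ζ : ι → ℂ} {A : ℝ}
    (hfin : ∀ R, {k | ‖ζ k‖ ≤ R}.Finite)
    (hA : ∀ R, 1 ≤ R → ({k | ‖ζ k‖ ≤ R}.ncard : ℝ) ≤ A * R) :
    Summable fun k => (‖ζ k‖ ^ 2)⁻¹ := by
  classical
  -- summing over `j` first counts each member with weight comparable to `1 / ‖ζ k‖ ^ 2`,
  -- summing over `k` first gives `ncard * 4 ^ (-j) = O(2 ^ (-j))`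
  let F : ℕ × ι → ℝ := fun p => if ‖ζ p.2‖ ≤ 2 ^ p.1 then ((4 : ℝ) ^ p.1)⁻¹ else 0
  have hF0 : 0 ≤ F := fun p => by
    simp only [F, Pi.zero_apply]; split_ifs <;> positivity
  have hrow : ∀ j : ℕ, HasSum (fun k => F (j, k))
      (({k | ‖ζ k‖ ≤ (2 : ℝ) ^ j}.ncard : ℝ) * ((4 : ℝ) ^ j)⁻¹) := by
    intro j
    have h := hasSum_sum_of_ne_finset_zero (L := .unconditional ι)
      (f := fun k => F (j, k))
      (s := (hfin ((2 : ℝ) ^ j)).toFinset) (fun k hk => by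
        simp only [Finite.mem_toFinset, mem_ofPred_eq] at hk
        simp only [F, if_neg hk])
    convert h using 1
    rw [Finset.sum_congr rfl (g := fun _ => ((4 : ℝ) ^ j)⁻¹) (fun k hk => by
      simp only [Finite.mem_toFinset, mem_ofPred_eq] at hk
      simp only [F, if_pos hk]), Finset.sum_const, nsmul_eq_mul,
      Set.ncard_eq_toFinset_card _ (hfin _)]
  have hF : Summable F := by
    refine (summable_prod_of_nonneg hF0).2 ⟨fun j => (hrow j).summable, ?_⟩
    refine Summable.of_nonneg_of_le (fun j => tsum_nonneg fun k => hF0 (j, k)) (fun j => ?_)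
      ((summable_geometric_two).mul_left A)
    rw [(hrow j).tsum_eq]
    calc _ ≤ A * 2 ^ j * ((4 : ℝ) ^ j)⁻¹ := by
          gcongr; exact hA _ (one_le_pow₀ one_le_two)
      _ = A * (1 / 2) ^ j := by
          rw [mul_assoc, ← inv_pow, ← mul_pow]; norm_num
  have hnear : ∀ k, ∃ j : ℕ, 1 ≤ ‖ζ k‖ → (2 : ℝ) ^ j ≤ ‖ζ k‖ ∧ ‖ζ k‖ < 2 ^ (j + 1) := by
    intro k
    by_cases hk : 1 ≤ ‖ζ k‖
    · obtain ⟨j, hj⟩ := exists_nat_pow_near hk one_lt_two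
      exact ⟨j, fun _ => hj⟩
    · exact ⟨0, fun h => absurd h hk⟩
  choose J hJ using hnear
  have hinj : Function.Injective fun k => (J k + 1, k) := fun k l h => (Prod.ext_iff.1 h).2
  -- the members in the unit disc are not reached by the dyadic annuli, but are finite in number
  refine Summable.of_norm_bounded_eventually ((hF.comp_injective hinj).mul_left 4) ?_
  refine (hfin 1).subset fun k hk => ?_
  by_contra hk1
  have hk1' : 1 ≤ ‖ζ k‖ := by
    simp only [mem_ofPred_eq, not_le] at hk1
    exact hk1.le
  apply hk
  obtain ⟨h2, h3⟩ := hJ k hk1'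
  have h4 : (4 : ℝ) ^ J k ≤ ‖ζ k‖ ^ 2 := by
    calc (4 : ℝ) ^ J k = (2 ^ J k) ^ 2 := by rw [← pow_mul, mul_comm, pow_mul]; norm_num
      _ ≤ _ := by gcongr
  change ‖(‖ζ k‖ ^ 2)⁻¹‖ ≤ 4 * F (J k + 1, k)
  rw [Real.norm_of_nonneg (by positivity)]
  calc (‖ζ k‖ ^ 2)⁻¹ ≤ (4 ^ J k)⁻¹ := by gcongr
    _ = 4 * F (J k + 1, k) := by
        simp only [F, if_pos h3.le, pow_succ, mul_inv]
        ring

/-! ### Hadamard factorization -/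

theorem norm_one_sub_mul_exp_sub_one_le {w : ℂ} (hw : ‖w‖ ≤ 1) :
    ‖(1 - w) * Complex.exp w - 1‖ ≤ 3 * ‖w‖ ^ 2 := by
  have h1 := Complex.norm_exp_sub_one_sub_id_le hw
  have h2 := Complex.norm_exp_sub_one_le hw
  calc ‖(1 - w) * Complex.exp w - 1‖
      = ‖(Complex.exp w - 1 - w) - w * (Complex.exp w - 1)‖ := by congr 1; ring
    _ ≤ ‖w‖ ^ 2 + ‖w‖ * (2 * ‖w‖) := by
        refine (norm_sub_le _ _).trans ?_
        rw [norm_mul]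
        gcongr
    _ = _ := by ring

/-- The canonical product of genus one converges locally uniformly when the inverse squares of its
zeros are summable. -/
theorem multipliableLocallyUniformlyOn_one_sub_div_mul_exp {ι : Type*} {ζ : ι → ℂ}
    (hfin : ∀ R, {k | ‖ζ k‖ ≤ R}.Finite) (hsum : Summable fun k => (‖ζ k‖ ^ 2)⁻¹) :
    MultipliableLocallyUniformlyOn
      (fun (k : ι) (z : ℂ) => (1 - z / ζ k) * Complex.exp (z / ζ k)) univ := by
  refine (hasProdLocallyUniformlyOn_of_forall_compact
    (g := fun z => ∏' k, (1 - z / ζ k) * Complex.exp (z / ζ k)) isOpen_univ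
    fun K _ hK => ?_).multipliableLocallyUniformlyOn
  obtain ⟨r, hr⟩ := hK.isBounded.exists_norm_le
  have h := (hsum.mul_left (3 * r ^ 2)).hasProdUniformlyOn_one_add
    (f := fun (k : ι) (z : ℂ) => (1 - z / ζ k) * Complex.exp (z / ζ k) - 1) hK ?_
    (fun k => by fun_prop)
  · simpa only [add_sub_cancel] using h
  · refine (hfin (max r 0)).subset fun k hk => ?_
    by_contra hk1
    apply hk
    intro z hz
    simp only [mem_ofPred_eq, not_le, max_lt_iff] at hk1
    have hq : ‖z / ζ k‖ ≤ 1 := by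
      rw [norm_div, div_le_one hk1.2]
      exact (hr z hz).trans hk1.1.le
    refine (norm_one_sub_mul_exp_sub_one_le hq).trans ?_
    rw [norm_div, div_pow, div_eq_mul_inv, ← mul_assoc]
    gcongr
    exact hr z hz

theorem hasDerivAt_prod_one_sub_div {ι : Type*} (ζ : ι → ℂ) (S : Finset ι) :
    HasDerivAt (fun z => ∏ k ∈ S, (1 - z / ζ k)) (-∑ k ∈ S, 1 / ζ k) 0 := by
  classical
  induction S using Finset.induction_on with
  | empty => simpa using hasDerivAt_const (0 : ℂ) (1 : ℂ)
  | insert k S hk ih =>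
    simp only [Finset.prod_insert hk, Finset.sum_insert hk]
    have hd : HasDerivAt (fun z : ℂ => 1 - z / ζ k) (-(1 / ζ k)) 0 :=
      ((hasDerivAt_id (0 : ℂ)).div_const (ζ k)).const_sub 1
    refine (hd.mul ih).congr_deriv ?_
    simp
    ring

/-- **Hadamard factorization** for entire functions of exponential type, normalized by `f 0 = 1`.
The factorization holds up to an error factor when only the zeros in the disc of radius `R` are
used, and the error tends to `1` since the quotient has logarithm of real part `O(R)`, hence
quadratic remainder `O(R) / R ^ 2`. -/
theorem IsZeroEnumeration.eq_exp_mul_tprod {ι : Type*} {f : ℂ → ℂ} {ζ : ι → ℂ}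
    (hζ : IsZeroEnumeration f ζ) (hf : Differentiable ℂ f) (h1 : f 0 = 1) {C τ : ℝ}
    (hC : ∀ z, ‖f z‖ ≤ C * Real.exp (τ * ‖z‖)) (hτ : 0 < τ) :
    MultipliableLocallyUniformlyOn
      (fun (k : ι) (z : ℂ) => (1 - z / ζ k) * Complex.exp (z / ζ k)) univ ∧
    ∀ z, f z = Complex.exp (deriv f 0 * z) * ∏' k, (1 - z / ζ k) * Complex.exp (z / ζ k) := by
  classical
  have hfin := hζ.finite_norm_le hf h1
  obtain ⟨A, hA⟩ := hζ.exists_ncard_le hf h1 hC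
  have hmul := multipliableLocallyUniformlyOn_one_sub_div_mul_exp hfin
    (summable_inv_norm_sq_of_ncard_le hfin hA)
  refine ⟨hmul, fun z => ?_⟩
  have hC1 : 1 ≤ C := by simpa [h1] using hC 0
  let S : ℕ → Finset ι := fun n => (hfin n).toFinset
  have hS : Tendsto S atTop atTop := by
    refine tendsto_atTop_finset_of_monotone (fun m n hmn => ?_) fun k => ?_
    · intro k hk
      simp only [S, Finite.mem_toFinset, mem_ofPred_eq] at hk ⊢
      exact hk.trans (by exact_mod_cast hmn)
    · obtain ⟨n, hn⟩ := exists_nat_ge ‖ζ k‖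
      exact ⟨n, by simpa [S] using hn⟩
  have hprod := (hmul.multipliable (mem_univ z)).hasProd.comp hS
  have key : ∀ n : ℕ, 0 < n → 2 * ‖z‖ < n → ∃ e : ℂ,
      f z = Complex.exp (deriv f 0 * z) *
        (∏ k ∈ S n, (1 - z / ζ k) * Complex.exp (z / ζ k)) * Complex.exp e ∧
      ‖e‖ ≤ 16 * (Real.log C + τ * (3 * n)) * ‖z‖ ^ 2 / n ^ 2 := by
    intro n hn hzn
    have hn0 : (0 : ℝ) < n := by exact_mod_cast hn
    obtain ⟨g, hg, hfg, hg1, hg0, hgb⟩ := hζ.exists_quotient hf h1 hC hn0 (S n) (by simp [S])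
    obtain ⟨h, hh, hh0, hgh⟩ := exists_eq_exp_on_ball hn0 hg.differentiableOn hg0 hg1
    have hre : ∀ w ∈ ball (0 : ℂ) n, (h w).re ≤ Real.log C + τ * (3 * n) := by
      intro w hw
      have h3 := hgb w (ball_subset_ball (by linarith) hw)
      rw [hgh w hw, Complex.norm_exp] at h3
      have h4 : Real.exp (h w).re ≤ Real.exp (Real.log C + τ * (3 * n)) := by
        rw [Real.exp_add, Real.exp_log (by positivity)]
        exact h3.trans (div_le_self (by positivity) (one_le_pow₀ one_le_two))
      exact Real.exp_le_exp.1 h4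
    have hpos : 0 < Real.log C + τ * (3 * n) := by
      have := Real.log_nonneg hC1
      positivity
    -- the error is the quadratic remainder of `h`; its linear part combines with the
    -- exponentials `exp (z / ζ k)` to give `exp (deriv f 0 * z)`
    refine ⟨h z - deriv h 0 * z, ?_, norm_sub_deriv_mul_le_of_re_le hn0 hpos hh hh0 hre
      (by linarith)⟩
    have hdg : HasDerivAt g (deriv h 0) 0 := by
      have hd : HasDerivAt h (deriv h 0) 0 :=
        (hh.differentiableAt (ball_mem_nhds _ hn0)).hasDerivAt
      have := hd.cexp
      rw [hh0, Complex.exp_zero, one_mul] at this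
      exact this.congr_of_eventuallyEq (eventually_of_mem (ball_mem_nhds _ hn0) hgh)
    have hdf : deriv f 0 = deriv h 0 - ∑ k ∈ S n, 1 / ζ k := by
      have hd := (hasDerivAt_prod_one_sub_div ζ (S n)).mul hdg
      rw [(hd.congr_of_eventuallyEq (Eventually.of_forall hfg)).deriv, hg1]
      simp
      ring
    have hz : z ∈ ball (0 : ℂ) n := by
      have := norm_nonneg z
      simp only [mem_ball, dist_zero_right]
      linarith
    rw [hfg, hgh z hz, Finset.prod_mul_distrib, ← Complex.exp_sum, mul_comm (Complex.exp _),
      mul_assoc, mul_assoc, ← Complex.exp_add, ← Complex.exp_add, hdf]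
    congr 2
    rw [sub_mul, Finset.sum_mul]
    simp only [one_div_mul_eq_div]
    ring
  obtain ⟨N, hN⟩ := exists_nat_gt (2 * ‖z‖)
  have hev : ∀ᶠ n : ℕ in atTop, 0 < n ∧ 2 * ‖z‖ < n := by
    filter_upwards [eventually_gt_atTop 0, eventually_ge_atTop N] with n h0 hn
    exact ⟨h0, hN.trans_le (by exact_mod_cast hn)⟩
  have hchoose : ∀ n : ℕ, ∃ e : ℂ, 0 < n ∧ 2 * ‖z‖ < n →
      f z = Complex.exp (deriv f 0 * z) *
        (∏ k ∈ S n, (1 - z / ζ k) * Complex.exp (z / ζ k)) * Complex.exp e ∧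
      ‖e‖ ≤ 16 * (Real.log C + τ * (3 * n)) * ‖z‖ ^ 2 / n ^ 2 := by
    intro n
    by_cases h : 0 < n ∧ 2 * ‖z‖ < n
    · obtain ⟨e, he⟩ := key n h.1 h.2
      exact ⟨e, fun _ => he⟩
    · exact ⟨0, fun h' => absurd h' h⟩
  choose e he using hchoose
  have hbound : Tendsto (fun n : ℕ => 16 * (Real.log C + τ * (3 * n)) * ‖z‖ ^ 2 / (n : ℝ) ^ 2)
      atTop (𝓝 0) := by
    have hinv : Tendsto (fun n : ℕ => ((n : ℝ))⁻¹) atTop (𝓝 0) :=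
      tendsto_inv_atTop_nhds_zero_nat
    have := ((hinv.mul hinv).const_mul (16 * Real.log C * ‖z‖ ^ 2)).add
      (hinv.const_mul (48 * τ * ‖z‖ ^ 2))
    simp only [mul_zero, add_zero] at this
    refine this.congr' ?_
    filter_upwards [eventually_gt_atTop 0] with n hn
    have : (n : ℝ) ≠ 0 := by exact_mod_cast hn.ne'
    field_simp
    ring
  have he0 : Tendsto e atTop (𝓝 0) :=
    squeeze_zero_norm' (hev.mono fun n hn => (he n hn).2) hbound
  have hlim := (hprod.const_mul (Complex.exp (deriv f 0 * z))).mul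
    ((Complex.continuous_exp.tendsto 0).comp he0)
  rw [Complex.exp_zero, mul_one] at hlim
  refine tendsto_nhds_unique (tendsto_const_nhds.congr' ?_) hlim
  filter_upwards [hev] with n hn
  exact (he n hn).1

/-! ### Existence of enumerations of the zeros -/

/-- The zeros of an entire function, indexed with multiplicity: the index type has one copy of `w`
for each unit of the order of vanishing at `w`. -/
theorem isZeroEnumeration_sigma {f : ℂ → ℂ} (hf : Differentiable ℂ f) (h1 : f 0 = 1) :
    IsZeroEnumeration f
      (fun p : Σ w : {w : ℂ // f w = 0}, Fin (analyticOrderNatAt f (w : ℂ)) => (p.1 : ℂ)) := by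
  intro w
  by_cases hw : f w = 0
  · have hset : {p : Σ w : {w : ℂ // f w = 0}, Fin (analyticOrderNatAt f (w : ℂ)) |
        (p.1 : ℂ) = w} = range (Sigma.mk (⟨w, hw⟩ : {w : ℂ // f w = 0})) := by
      ext ⟨⟨x, hx⟩, i⟩
      constructor
      · rintro rfl
        exact ⟨i, rfl⟩
      · rintro ⟨j, hj⟩
        exact (congrArg (fun p => (p.1 : ℂ)) hj).symm
    rw [hset, ← image_univ, sigma_mk_injective.encard_image, Set.encard_univ,
      ENat.card_eq_coe_fintype_card, Fintype.card_fin,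
      Nat.cast_analyticOrderNatAt (analyticOrderAt_ne_top_of_apply_zero hf h1 w)]
  · rw [(hf.analyticAt w).analyticOrderAt_eq_zero.2 hw, Set.encard_eq_zero]
    ext ⟨⟨x, hx⟩, i⟩
    simp only [mem_ofPred_eq, mem_empty_iff_false, iff_false]
    rintro rfl
    exact hw hx

theorem countable_zeros {f : ℂ → ℂ} (hf : Differentiable ℂ f) (h1 : f 0 = 1) :
    Countable {w : ℂ // f w = 0} := by
  have h : {w : ℂ | f w = 0} ⊆ ⋃ n : ℕ, {w : ℂ | ‖w‖ ≤ n ∧ f w = 0} := fun w hw => by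
    obtain ⟨n, hn⟩ := exists_nat_ge ‖w‖
    exact mem_iUnion.2 ⟨n, hn, hw⟩
  exact ((countable_iUnion fun n : ℕ => (finite_zeros_closedBall hf h1 n).countable).mono
    h).to_subtype

theorem IsZeroEnumeration.comp_equiv {ι κ : Type*} {f : ℂ → ℂ} {ζ : ι → ℂ}
    (hζ : IsZeroEnumeration f ζ) (e : κ ≃ ι) : IsZeroEnumeration f (ζ ∘ e) := fun w => by
  rw [← hζ w]
  exact Set.encard_preimage_of_bijective e.bijective {k | ζ k = w}

/-! ### Exponential generating functions -/

/-- The exponential generating function `∑ₖ vₖ zᵏ / k!` of a sequence `v`, as an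
honest sum whenever `v` grows at most geometrically. -/
noncomputable def expGenFun (v : ℕ → ℂ) (z : ℂ) : ℂ :=
  ∑' k : ℕ, v k * (z ^ k / (k.factorial : ℂ))

section ExpGenFun

variable {v : ℕ → ℂ} {C : ℝ}

theorem norm_expGenFun_term_le (hv : ∀ k, ‖v k‖ ≤ C * 2 ^ k) (z : ℂ) (k : ℕ) :
    ‖v k * (z ^ k / (k.factorial : ℂ))‖ ≤ C * ((2 * ‖z‖) ^ k / k.factorial) := by
  rw [norm_mul, norm_div, norm_pow, Complex.norm_natCast, mul_pow]
  calc _ ≤ C * 2 ^ k * (‖z‖ ^ k / k.factorial) := by gcongr; exact hv k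
    _ = _ := by ring

theorem hasSum_expGenFun (hv : ∀ k, ‖v k‖ ≤ C * 2 ^ k) (z : ℂ) :
    HasSum (fun k => v k * (z ^ k / (k.factorial : ℂ))) (expGenFun v z) :=
  (Summable.of_norm_bounded ((Real.summable_pow_div_factorial (2 * ‖z‖)).mul_left C)
    (norm_expGenFun_term_le hv z)).hasSum

theorem norm_expGenFun_le (hv : ∀ k, ‖v k‖ ≤ C * 2 ^ k) (z : ℂ) :
    ‖expGenFun v z‖ ≤ C * Real.exp (2 * ‖z‖) := by
  refine tsum_of_norm_bounded (HasSum.mul_left C ?_) (norm_expGenFun_term_le hv z)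
  rw [Real.exp_eq_exp_ℝ]
  exact NormedSpace.expSeries_div_hasSum_exp (2 * ‖z‖)

theorem norm_succ_le_of_norm_le (hv : ∀ k, ‖v k‖ ≤ C * 2 ^ k) (k : ℕ) :
    ‖v (k + 1)‖ ≤ (2 * C) * 2 ^ k := by
  refine (hv (k + 1)).trans_eq ?_
  ring

theorem expGenFun_zero (v : ℕ → ℂ) : expGenFun v 0 = v 0 := by
  rw [expGenFun, tsum_eq_single 0]
  · simp
  · intro k hk
    simp [hk]

theorem natCast_succ_mul_pow_div_factorial (w : ℂ) (k : ℕ) :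
    ((k + 1 : ℕ) : ℂ) * (w / ((k + 1).factorial : ℂ)) = w / (k.factorial : ℂ) := by
  have h1 : ((k.factorial : ℕ) : ℂ) ≠ 0 := by exact_mod_cast k.factorial_ne_zero
  have h2 : ((k : ℂ) + 1) ≠ 0 := by exact_mod_cast k.succ_ne_zero
  rw [Nat.factorial_succ]
  push_cast
  field_simp

/-- Differentiating an exponential generating function shifts its sequence. -/
theorem hasDerivAt_expGenFun (hv : ∀ k, ‖v k‖ ≤ C * 2 ^ k) (z : ℂ) :
    HasDerivAt (expGenFun v) (expGenFun (fun k => v (k + 1)) z) z := by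
  have hv' := norm_succ_le_of_norm_le hv
  have hshift : ∀ (y : ℂ) (k : ℕ),
      v (k + 1) * (((k + 1 : ℕ) : ℂ) * y ^ (k + 1 - 1) / ((k + 1).factorial : ℂ)) =
        v (k + 1) * (y ^ k / (k.factorial : ℂ)) := fun y k => by
    rw [mul_div_assoc, natCast_succ_mul_pow_div_factorial, Nat.add_sub_cancel]
  set r : ℝ := ‖z‖ + 1
  have hr : 0 ≤ r := by positivity
  have hsum : Summable fun k : ℕ => ‖v k * ((k : ℂ) * (r : ℂ) ^ (k - 1) / (k.factorial : ℂ))‖ := by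
    rw [← summable_nat_add_iff 1]
    simp only [hshift]
    exact (hasSum_expGenFun hv' (r : ℂ)).summable.norm
  have h := hasDerivAt_tsum_of_isPreconnected (𝕜 := ℂ)
    (g := fun (k : ℕ) (y : ℂ) => v k * (y ^ k / (k.factorial : ℂ)))
    (g' := fun (k : ℕ) (y : ℂ) => v k * ((k : ℂ) * y ^ (k - 1) / (k.factorial : ℂ)))
    hsum (isOpen_ball (x := (0 : ℂ)) (ε := r)) (convex_ball _ _).isPreconnected
    (fun k y _ => ((hasDerivAt_pow k y).div_const _).const_mul _)
    (fun k y hy => by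
      have hy' : ‖y‖ ≤ r := by simpa using (mem_ball_zero_iff.1 hy).le
      simp only [norm_mul, norm_div, norm_pow, Complex.norm_real, Real.norm_of_nonneg hr]
      gcongr)
    (y₀ := z) (by simp [r]) (hasSum_expGenFun hv z).summable (y := z) (by simp [r])
  refine h.congr_deriv ?_
  have hsum' : Summable fun k : ℕ => v k * ((k : ℂ) * z ^ (k - 1) / (k.factorial : ℂ)) := by
    rw [← summable_nat_add_iff 1]
    simp only [hshift]
    exact (hasSum_expGenFun hv' z).summable
  rw [hsum'.tsum_eq_zero_add]
  simp only [hshift]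
  simp [expGenFun]

theorem hasSum_natCast_mul_expGenFun (hv : ∀ k, ‖v k‖ ≤ C * 2 ^ k) (z : ℂ) :
    HasSum (fun k : ℕ => (k : ℂ) * v k * (z ^ k / (k.factorial : ℂ)))
      (z * expGenFun (fun k => v (k + 1)) z) := by
  rw [← hasSum_nat_add_iff' 1]
  simp only [Finset.sum_range_one, Nat.cast_zero, zero_mul, sub_zero]
  refine ((hasSum_expGenFun (norm_succ_le_of_norm_le hv) z).mul_left z).congr_fun ?_
  intro k
  rw [mul_comm ((k + 1 : ℕ) : ℂ), mul_assoc, natCast_succ_mul_pow_div_factorial]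
  ring

end ExpGenFun

/-! ### The Kummer function -/

section Kummer

variable {a c : ℂ}

theorem kummerM_eq_expGenFun (a c : ℂ) :
    kummerM a c = expGenFun
      (fun k => (ascPochhammer ℂ k).eval a / (ascPochhammer ℂ k).eval c) := rfl

theorem kummer_coeff_succ (hc : ∀ n : ℕ, c + n ≠ 0) (k : ℕ) :
    (c + k) * ((ascPochhammer ℂ (k + 1)).eval a / (ascPochhammer ℂ (k + 1)).eval c) =
      (a + k) * ((ascPochhammer ℂ k).eval a / (ascPochhammer ℂ k).eval c) := by
  rw [ascPochhammer_succ_eval, ascPochhammer_succ_eval, mul_div_mul_comm, mul_left_comm,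
    mul_div_cancel₀ _ (hc k), mul_comm]

/-- The ratio of consecutive coefficients tends to `1`, so the coefficients are
`O(2 ^ k)`. -/
theorem exists_norm_kummer_coeff_le (a : ℂ) (hc : ∀ n : ℕ, c + n ≠ 0) :
    ∃ C : ℝ, ∀ k, ‖(ascPochhammer ℂ k).eval a / (ascPochhammer ℂ k).eval c‖ ≤ C * 2 ^ k := by
  set v : ℕ → ℂ := fun k => (ascPochhammer ℂ k).eval a / (ascPochhammer ℂ k).eval c with hv
  have hsum : Summable fun k => v k / 2 ^ k := by
    refine summable_of_ratio_norm_eventually_le (r := 3 / 4) (by norm_num) ?_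
    obtain ⟨N, hN⟩ := exists_nat_ge (2 * ‖a‖ + 3 * ‖c‖)
    filter_upwards [eventually_ge_atTop N] with k hk
    have hk' : 2 * ‖a‖ + 3 * ‖c‖ ≤ k := hN.trans (by exact_mod_cast hk)
    have h1 : ‖a + k‖ ≤ ‖a‖ + k := (norm_add_le _ _).trans_eq (by simp)
    have h2 : (k : ℝ) - ‖c‖ ≤ ‖c + k‖ := by
      have := norm_sub_norm_le (k : ℂ) (-c)
      simpa [add_comm] using this
    have h3 : ‖a + k‖ ≤ 3 / 2 * ‖c + k‖ := by linarith
    have h4 : ‖c + k‖ * ‖v (k + 1)‖ = ‖a + k‖ * ‖v k‖ := by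
      rw [← norm_mul, ← norm_mul, hv, kummer_coeff_succ hc]
    have h5 : ‖v (k + 1)‖ ≤ 3 / 2 * ‖v k‖ := by
      refine le_of_mul_le_mul_left ?_ (norm_pos_iff.2 (hc k))
      rw [h4]
      nlinarith [norm_nonneg (v k)]
    rw [norm_div (v (k + 1)), norm_div (v k), norm_pow, norm_pow, Complex.norm_ofNat, pow_succ,
      div_le_iff₀ (by positivity)]
    refine h5.trans_eq ?_
    field_simp
    ring
  obtain ⟨C, hC⟩ := hsum.tendsto_atTop_zero.norm.bddAbove_range
  refine ⟨C, fun k => ?_⟩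
  have := hC ⟨k, rfl⟩
  simp only [norm_div, norm_pow, Complex.norm_ofNat] at this
  simpa [hv] using (div_le_iff₀ (by positivity)).1 this

/-- The derivative of the Kummer function, and the differential equation
`z * w'' + (c - z) * w' = a * w` which it solves. -/
theorem exists_kummerM_deriv (a : ℂ) (hc : ∀ n : ℕ, c + n ≠ 0) :
    ∃ f₁ f₂ : ℂ → ℂ, (∀ z, HasDerivAt (kummerM a c) (f₁ z) z) ∧ (∀ z, HasDerivAt f₁ (f₂ z) z) ∧
      f₁ 0 = a / c ∧ ∀ z, z * f₂ z + (c - z) * f₁ z = a * kummerM a c z := by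
  obtain ⟨C, hC⟩ := exists_norm_kummer_coeff_le a hc
  rw [kummerM_eq_expGenFun]
  set v : ℕ → ℂ := fun k => (ascPochhammer ℂ k).eval a / (ascPochhammer ℂ k).eval c with hv
  have hC' := norm_succ_le_of_norm_le (v := v) hC
  refine ⟨expGenFun fun k => v (k + 1), expGenFun fun k => v (k + 2),
    hasDerivAt_expGenFun hC, hasDerivAt_expGenFun hC', ?_, fun z => ?_⟩
  · simp [expGenFun_zero, hv]
  · have h := ((hasSum_natCast_mul_expGenFun hC' z).add
      ((hasSum_expGenFun hC' z).mul_left c)).sub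
      ((hasSum_natCast_mul_expGenFun (v := v) hC z).add
        ((hasSum_expGenFun (v := v) hC z).mul_left a))
    have h0 : ∀ k : ℕ, (k : ℂ) * v (k + 1) * (z ^ k / (k.factorial : ℂ)) +
        c * (v (k + 1) * (z ^ k / (k.factorial : ℂ))) -
        ((k : ℂ) * v k * (z ^ k / (k.factorial : ℂ)) +
          a * (v k * (z ^ k / (k.factorial : ℂ)))) = 0 := fun k => by
      linear_combination (z ^ k / (k.factorial : ℂ)) * kummer_coeff_succ (a := a) hc k
    simp only [h0] at h
    linear_combination h.unique hasSum_zero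

theorem kummerM_zero (a c : ℂ) : kummerM a c 0 = 1 := by
  simp [kummerM_eq_expGenFun, expGenFun_zero]

/-- A function `P z * exp (γ * z)` with `P` a nonzero polynomial solves Kummer's equation only if
`a` or `c - a` is a nonpositive integer: comparing the two leading coefficients gives `γ ^ 2 = γ`
and then determines the degree of `P`. -/
theorem exists_natCast_of_eval_mul_exp_eq_kummerM (hc : ∀ n : ℕ, c + n ≠ 0)
    {P : Polynomial ℂ} (hP : P ≠ 0) {γ : ℂ}
    (h : ∀ z, kummerM a c z = P.eval z * Complex.exp (γ * z)) :
    ∃ n : ℕ, a = -n ∨ c - a = -n := by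
  obtain ⟨f₁, f₂, hf₁, hf₂, -, hode⟩ := exists_kummerM_deriv a hc
  have hexp : ∀ (Q : Polynomial ℂ) (z : ℂ),
      HasDerivAt (fun z => Q.eval z * Complex.exp (γ * z))
        ((Q.derivative + Polynomial.C γ * Q).eval z * Complex.exp (γ * z)) z := by
    intro Q z
    have he : HasDerivAt (fun z => Complex.exp (γ * z)) (Complex.exp (γ * z) * γ) z := by
      simpa using ((hasDerivAt_id z).const_mul γ).cexp
    refine ((Q.hasDerivAt z).mul he).congr_deriv ?_
    simp
    ring
  set P₁ := P.derivative + Polynomial.C γ * P with hP₁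
  set P₂ := P₁.derivative + Polynomial.C γ * P₁ with hP₂
  have e₁ : ∀ z, f₁ z = P₁.eval z * Complex.exp (γ * z) := fun z =>
    (hf₁ z).unique ((hexp P z).congr_of_eventuallyEq (Eventually.of_forall h))
  have e₂ : ∀ z, f₂ z = P₂.eval z * Complex.exp (γ * z) := fun z =>
    (hf₂ z).unique ((hexp P₁ z).congr_of_eventuallyEq (Eventually.of_forall e₁))
  have hpoly : Polynomial.X * P₂ + Polynomial.C c * P₁ - Polynomial.X * P₁
      - Polynomial.C a * P = 0 := by
    refine Polynomial.funext fun z => ?_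
    have hz := hode z
    rw [e₁, e₂, h] at hz
    refine mul_right_cancel₀ (Complex.exp_ne_zero (γ * z)) ?_
    simp only [Polynomial.eval_sub, Polynomial.eval_add, Polynomial.eval_mul, Polynomial.eval_X,
      Polynomial.eval_C, Polynomial.eval_zero, zero_mul]
    linear_combination hz
  set n := P.natDegree with hn
  have hlead : P.coeff n ≠ 0 := by simpa [hn] using hP
  have hz1 : P.coeff (n + 1) = 0 := Polynomial.coeff_eq_zero_of_natDegree_lt (by omega)
  have hz2 : P.coeff (n + 2) = 0 := Polynomial.coeff_eq_zero_of_natDegree_lt (by omega)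
  -- the coefficient of degree `n + 1` is `(γ ^ 2 - γ) * P.coeff n`
  have htop := congrArg (fun Q => Q.coeff (n + 1)) hpoly
  simp only [hP₁, hP₂, Polynomial.coeff_sub, Polynomial.coeff_add, Polynomial.coeff_X_mul,
    Polynomial.coeff_C_mul, Polynomial.coeff_derivative, Polynomial.derivative_add,
    Polynomial.derivative_mul, Polynomial.derivative_C, zero_mul, zero_add,
    Polynomial.coeff_zero, add_assoc, Nat.reduceAdd, hz1, hz2, mul_zero, add_zero] at htop
  have hγ : γ = 0 ∨ γ = 1 := by
    have : (γ * (γ - 1)) * P.coeff n = 0 := by linear_combination htop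
    rcases mul_eq_zero.1 ((mul_eq_zero.1 this).resolve_right hlead) with h | h
    · exact Or.inl h
    · exact Or.inr (sub_eq_zero.1 h)
  have hnext : (2 * γ * n + c * γ - n - a) * P.coeff n = 0 := by
    have hγ2 : γ ^ 2 = γ := by rcases hγ with h | h <;> simp [h]
    have hcoeff := congrArg (fun Q => Q.coeff n) hpoly
    -- multiplication by `X` shifts coefficients, with nothing below degree zero
    rcases hm : n with _ | m
    · rw [hm] at hcoeff hz1
      simp only [hP₁, hP₂, Polynomial.coeff_sub, Polynomial.coeff_add, Polynomial.coeff_X_mul_zero,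
        Polynomial.coeff_C_mul, Polynomial.coeff_derivative, Polynomial.coeff_zero, zero_add,
        hz1] at hcoeff
      push_cast
      linear_combination hcoeff
    · rw [hm] at hcoeff hz1
      simp only [hP₁, hP₂, Polynomial.coeff_sub, Polynomial.coeff_add, Polynomial.coeff_X_mul,
        Polynomial.coeff_C_mul, Polynomial.coeff_derivative, Polynomial.coeff_zero,
        hz1, zero_mul, zero_add] at hcoeff
      push_cast at hcoeff ⊢
      linear_combination hcoeff - P.coeff m * hγ2
  have hnext' := (mul_eq_zero.1 hnext).resolve_right hlead
  refine ⟨n, ?_⟩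
  rcases hγ with rfl | rfl
  · exact Or.inl (by linear_combination -hnext')
  · exact Or.inr (by linear_combination hnext')

end Kummer

/-! ### The factorization of the Kummer function -/

theorem ofReal_add_ofReal_add_natCast_ne_zero {a b : ℝ} (hab : ∀ n : ℕ, a + b ≠ -(n : ℝ))
    (n : ℕ) : (a : ℂ) + (b : ℂ) + n ≠ 0 := by
  intro h
  apply hab n
  have : a + b + n = 0 := by exact_mod_cast h
  linarith

theorem mainTheorem2 (a b : ℝ) (hab : ∀ n : ℕ, a + b ≠ -(n : ℝ)) :
    (∀ (ι : Type) (ζ : ι → ℂ), IsZeroEnumeration (kummerPhi a b) ζ →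
      MultipliableLocallyUniformlyOn
        (fun (k : ι) (z : ℂ) => (1 - z / ζ k) * Complex.exp (z / ζ k)) Set.univ ∧
      ∀ z : ℂ, kummerPhi a b z =
        Complex.exp ((a : ℂ) * z / ((a : ℂ) + (b : ℂ))) *
          ∏' k : ι, (1 - z / ζ k) * Complex.exp (z / ζ k)) ∧
    ((∀ n : ℕ, a ≠ -(n : ℝ) ∧ b ≠ -(n : ℝ)) →
      ∃ ζ : ℕ → ℂ, IsZeroEnumeration (kummerPhi a b) ζ) := by
  have hc := ofReal_add_ofReal_add_natCast_ne_zero hab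
  have hPhi : kummerPhi a b = kummerM a (a + b) := rfl
  obtain ⟨f₁, f₂, hf₁, -, hf₁0, -⟩ := exists_kummerM_deriv (a : ℂ) hc
  have hf : Differentiable ℂ (kummerPhi a b) := fun z => (hf₁ z).differentiableAt
  have h1 : kummerPhi a b 0 = 1 := kummerM_zero _ _
  obtain ⟨C, hC⟩ := exists_norm_kummer_coeff_le (a : ℂ) hc
  have hderiv : deriv (kummerPhi a b) 0 = a / (a + b) := by
    rw [hPhi, (hf₁ 0).deriv, hf₁0]
  have hfact : ∀ (ι : Type) (ζ : ι → ℂ), IsZeroEnumeration (kummerPhi a b) ζ →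
      MultipliableLocallyUniformlyOn
        (fun (k : ι) (z : ℂ) => (1 - z / ζ k) * Complex.exp (z / ζ k)) Set.univ ∧
      ∀ z : ℂ, kummerPhi a b z =
        Complex.exp ((a : ℂ) * z / ((a : ℂ) + (b : ℂ))) *
          ∏' k : ι, (1 - z / ζ k) * Complex.exp (z / ζ k) := by
    intro ι ζ hζ
    obtain ⟨hm, he⟩ := hζ.eq_exp_mul_tprod hf h1 (norm_expGenFun_le hC) two_pos
    refine ⟨hm, fun z => ?_⟩
    rw [he z, hderiv, div_mul_eq_mul_div]
  refine ⟨hfact, fun hneg => ?_⟩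
  have hζ := isZeroEnumeration_sigma hf h1
  have := countable_zeros hf h1
  set ι := Σ w : {w : ℂ // kummerPhi a b w = 0}, Fin (analyticOrderNatAt (kummerPhi a b) (w : ℂ))
  have hinf : Infinite ι := by
    by_contra hfin
    rw [not_infinite_iff_finite] at hfin
    have := Fintype.ofFinite ι
    -- a finite product of genus-one factors is a polynomial times an exponential
    obtain ⟨n, hn⟩ := exists_natCast_of_eval_mul_exp_eq_kummerM (a := (a : ℂ)) hc
      (P := ∏ k : ι, (1 - Polynomial.C (1 / (k.1 : ℂ)) * Polynomial.X))
      (γ := (a : ℂ) / (a + b) + ∑ k : ι, 1 / (k.1 : ℂ))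
      (fun h => by
        have := congrArg (Polynomial.eval 0) h
        simp [Polynomial.eval_prod] at this)
      (fun z => by
        rw [← hPhi, (hfact ι _ hζ).2 z, tprod_fintype, Finset.prod_mul_distrib, ← Complex.exp_sum,
          add_mul, Complex.exp_add, Finset.sum_mul, Polynomial.eval_prod]
        simp only [Polynomial.eval_sub, Polynomial.eval_one, Polynomial.eval_mul,
          Polynomial.eval_C, Polynomial.eval_X, one_div_mul_eq_div]
        rw [div_mul_eq_mul_div]
        ring)
    rcases hn with hn | hn
    · exact (hneg n).1 (by exact_mod_cast hn)
    · rw [add_sub_cancel_left] at hn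
      exact (hneg n).2 (by exact_mod_cast hn)
  obtain ⟨e⟩ := nonempty_equiv_of_countable (α := ℕ) (β := ι)
  exact ⟨_, hζ.comp_equiv e⟩
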